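/- For an integer $n\ge 1$, let $A\in\mathbb{R}^{n\times n}$ be symmetric with singular values $\sigma_1(A)\ge\dots\ge\sigma_n(A)$, and put $\sigma_{n+1}(A)=0$; $\|\cdot\|_2$ is the spectral norm of a matrix and the Euclidean norm of a vector. The block Krylov method with input $A$, block size $l$, depth $q$ and tolerance exponent $\beta$ does the following. 1. Draw $X\in\mathbb{R}^{n\times l}$ with independent $\mathcal N(0,1)$ entries. 2. Form $\mathcal K_q=[AX,(AA^T)AX,\dots,(AA^T)^qAX]$, let $r=\operatorname{rank}\mathcal K_q$, and let $Q\in\mathbb{R}^{n\times r}$ have orthonormal columns spanning the range of $\mathcal K_q$. 3. Let $v_1,\dots,v_r$ be an orthonormal basis of eigenvectors of $T=Q^TAQ$, with eigenvalues ordered so that $|\lambda_1(T)|\ge\dots\ge|\lambda_r(T)|$. 4. Let $S=\{j\in\{1,\dots,r\} : \|AQv_j-\lambda_j(T)Qv_j\|_2\le \|A\|_2/n^{\beta}\}$ and return $Z_S=QV_S$, where $V_S$ is the matrix with columns $v_j$, $j\in S$. **Theorem.** For all constants $\beta,c_2,c'>0$ there is a constant $C>0$, depending only on $\beta,c_2,c'$,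 such that the following holds for all $n\ge 1$, all $l\in\{1,\dots,n\}$, all symmetric $A\in\mathbb{R}^{n\times n}$ and every depth $q\ge C\log n$ (in particular for $q=\lceil C\log n\rceil=O(\log n)$). With probability at least $1-\frac1{n^{c'}}$ over $X$, whatever choices of $Q$ and of $v_1,\dots,v_r$ the method makes, the projection $P=I-Z_SZ_S^T$ satisfies $$\|PAP\|_2\le 2\sigma_{l+1}(A)+\frac{\|A\|_2}{n^{c_2}} .$$ -/

import Mathlib

open MeasureTheory ProbabilityTheory
open scoped Matrix Matrix.Norms.L2Operator

namespace BlockKrylov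

/-- The law of an `n × l` random matrix with independent standard Gaussian entries. -/
noncomputable def gaussianBlock (n l : ℕ) : Measure (Fin n → Fin l → ℝ) :=
  Measure.pi fun _ => Measure.pi fun _ => gaussianReal 0 1

/-- The singular values `σ₁(A) ≥ σ₂(A) ≥ …` of a square matrix, listed from index `0`:
`sigma A i` is `σ_{i+1}(A)`, and it is `0` for `i ≥ n`. -/
noncomputable def sigma {n : ℕ} (A : Matrix (Fin n) (Fin n) ℝ) (i : ℕ) : ℝ :=
  (Matrix.toEuclideanLin A).singularValues i

/-- The block Krylov matrix `[A X, (A Aᵀ) A X, …, (A Aᵀ)^q A X]` of depth `q`. A column is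
indexed by the pair of its block and its place in the block. -/
def krylovMatrix {n l : ℕ} (A : Matrix (Fin n) (Fin n) ℝ) (X : Matrix (Fin n) (Fin l) ℝ)
    (q : ℕ) : Matrix (Fin n) (Fin (q + 1) × Fin l) ℝ :=
  Matrix.of fun a jb => ((A * Aᵀ) ^ (jb.1 : ℕ) * (A * X)) a jb.2

/-- A run of the block Krylov method on the input matrix `A` with start block `X` and depth `q`:
an orthonormal basis of the range of the Krylov matrix (the columns of `Q`), and an orthonormal
eigenbasis of `T = Qᵀ A Q` (the columns of `V`, with eigenvalues `lam`), ordered by decreasing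
absolute value of the eigenvalues. The basis and the eigenbasis are not unique; every admissible
choice is a run. -/
structure Run {n l : ℕ} (A : Matrix (Fin n) (Fin n) ℝ) (X : Matrix (Fin n) (Fin l) ℝ)
    (q : ℕ) where
  /-- the rank of the Krylov matrix -/
  r : ℕ
  rank_eq : r = (krylovMatrix A X q).rank
  /-- the orthonormalized Krylov matrix -/
  Q : Matrix (Fin n) (Fin r) ℝ
  orthonormal_Q : Qᵀ * Q = 1
  range_Q : LinearMap.range Q.mulVecLin = LinearMap.range (krylovMatrix A X q).mulVecLin
  /-- the eigenvectors of `Qᵀ A Q`, as columns -/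
  V : Matrix (Fin r) (Fin r) ℝ
  /-- the eigenvalues of `Qᵀ A Q` -/
  lam : Fin r → ℝ
  orthonormal_V : Vᵀ * V = 1
  eigen : ∀ j, (Qᵀ * A * Q) *ᵥ V.col j = lam j • V.col j
  sorted : Antitone fun j => |lam j|

namespace Run

variable {n l : ℕ} {A : Matrix (Fin n) (Fin n) ℝ} {X : Matrix (Fin n) (Fin l) ℝ} {q : ℕ}

/-- The set `S` of the indices `j` of converged eigenvectors:
`‖A Q v_j - λ_j Q v_j‖₂ ≤ ‖A‖₂ / n^β`. -/
noncomputable def converged (R : Run A X q) (β : ℝ) : Set (Fin R.r) :=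
  {j | ‖WithLp.toLp 2 (A *ᵥ (R.Q *ᵥ R.V.col j) - R.lam j • (R.Q *ᵥ R.V.col j))‖
    ≤ ‖A‖ / (n : ℝ) ^ β}

/-- The output `Z_S = Q V_S`: its columns are the converged approximate eigenvectors. -/
noncomputable def Z (R : Run A X q) (β : ℝ) : Matrix (Fin n) (R.converged β) ℝ :=
  R.Q * R.V.submatrix id (fun j : R.converged β => (j : Fin R.r))

open Classical in
/-- The deflating projection `P = I - Z_S Z_Sᵀ`. -/
noncomputable def P (R : Run A X q) (β : ℝ) : Matrix (Fin n) (Fin n) ℝ :=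
  1 - R.Z β * (R.Z β)ᵀ

end Run

end BlockKrylov

/-! Write `τ = σ_{l+1}(A)` and let `b i` be an eigenbasis with eigenvalues `μ i`, ordered so that
`|μ i| ≤ τ` from index `l` on. Let `U` hold the first `l` eigenvectors.

Randomness enters only through `Uᵀ X`, which with high probability is invertible with a polynomially
bounded inverse (`gaussianBlock_compl_goodBlocks_le`, `exists_solution_of_mem_goodBlocks`). The
event depends only on `X`, so every choice of `Q` and `V` is covered at once.

If `|μ i| > 3τ/2`, solve `Uᵀ X y = e_i`. Then `X y` has no component along the other leading
eigenvectors, and applying `A ^ (2q+1)` damps the rest by `2/3` per step relative to `b i`. Hence `b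
i` is within a polynomially small `δ` of the Krylov space once `q ≥ C log n`
(`norm_power_sub_eigenvector_le`). No gap between eigenvalues is needed.

The rest is deterministic. A Ritz pair with `|θ| ≥ 3τ/2 + γ` has a tiny residual
(`sq_norm_residual_le`), so it is converged. Each discarded Ritz value is therefore below `3τ/2 +
γ`, hence separated by at least `γ` from every eigenvalue above `2τ + 2γ` in absolute value. This
makes the discarded Ritz vectors almost orthogonal to those eigenvectors (`abs_inner_ritz_le`). So
`P` nearly kills these eigenvectors, and what survives in `P A P` has norm about `2τ + 2γ`
(`norm_deflation_comp_le`). -/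

namespace BlockKrylov

/-! ### One-dimensional Gaussian estimates and sections of the product measure. -/

section Gaussian

/-- A set has small product measure if all its sections along one coordinate are small. -/
lemma pi_le_of_section {ι : Type*} [Fintype ι] [DecidableEq ι] {Ω : ι → Type*}
    [∀ i, MeasurableSpace (Ω i)] (μ : ∀ i, Measure (Ω i)) [∀ i, IsProbabilityMeasure (μ i)]
    (i : ι) {B : Set (∀ i, Ω i)} (hB : MeasurableSet B) {ε : ENNReal}
    (h : ∀ x, μ i {t | Function.update x i t ∈ B} ≤ ε) : Measure.pi μ B ≤ ε := by
  have key := lintegral_le_of_lmarginal_le (μ := μ) {i} (f := B.indicator 1) (g := fun _ => ε)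
    (measurable_one.indicator hB) measurable_const (by
      intro x
      rw [lmarginal_singleton, lmarginal_singleton, lintegral_const, measure_univ, mul_one]
      refine le_trans (le_of_eq ?_) (h x)
      have hm : MeasurableSet {t | Function.update x i t ∈ B} := measurable_update x hB
      rw [← lintegral_indicator_one hm]
      rfl)
  rwa [lintegral_indicator_one hB, lintegral_const, measure_univ, mul_one] at key

/-- Replace the entry `(a, j)` of an array by `t`. -/
def updateEntry {n l : ℕ} (X : Fin n → Fin l → ℝ) (a : Fin n) (j : Fin l) (t : ℝ) :
    Fin n → Fin l → ℝ :=
  Function.update X a (Function.update (X a) j t)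

lemma gaussianBlock_le_of_section {n l : ℕ} (a : Fin n) (j : Fin l)
    {B : Set (Fin n → Fin l → ℝ)} (hB : MeasurableSet B) {ε : ENNReal}
    (h : ∀ X, gaussianReal 0 1 {t | updateEntry X a j t ∈ B} ≤ ε) : gaussianBlock n l B ≤ ε := by
  refine pi_le_of_section _ a hB fun X => ?_
  refine pi_le_of_section (fun _ : Fin l => gaussianReal 0 1) j (measurable_update X hB) fun r => ?_
  have := h (Function.update X a r)
  simpa [updateEntry] using this

instance (n l : ℕ) : IsProbabilityMeasure (gaussianBlock n l) := by
  unfold gaussianBlock; infer_instance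

lemma gaussianReal_le_volume (s : Set ℝ) : gaussianReal 0 1 s ≤ volume s := by
  rw [gaussianReal_apply 0 one_ne_zero]
  calc ∫⁻ x in s, gaussianPDF 0 1 x ≤ ∫⁻ x in s, 1 := by
        refine lintegral_mono fun x => ?_
        rw [gaussianPDF, ENNReal.ofReal_le_one, gaussianPDFReal]
        refine mul_le_one₀ (inv_le_one_of_one_le₀ ?_) (Real.exp_pos _).le
          (Real.exp_le_one_iff.2 ?_)
        · rw [Real.one_le_sqrt]
          norm_num
          nlinarith [Real.pi_gt_three]
        · exact div_nonpos_of_nonpos_of_nonneg (by nlinarith [sq_nonneg (x - 0)]) (by positivity)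
    _ = volume s := by simp

lemma gaussianReal_tail {ε : ℝ} (hε : 0 < ε) (hε1 : ε ≤ 1) :
    gaussianReal 0 1 {t | 1 / ε ≤ |t|} ≤ ENNReal.ofReal ε := by
  have h := meas_ge_le_variance_div_sq (memLp_id_gaussianReal (μ := 0) (v := 1) 2)
    (c := 1 / ε) (by positivity)
  simp only [variance_id_gaussianReal, id, integral_id_gaussianReal, sub_zero] at h
  refine h.trans (ENNReal.ofReal_le_ofReal ?_)
  simp only [NNReal.coe_one, one_div, inv_pow, inv_inv]
  nlinarith

/-- Anti-concentration: the density is at most 1 and the set lies in an interval of length `2 * ε`.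
The nonvanishing clause makes the set empty when the slope `w` is zero. -/
lemma gaussianReal_affine_small (c w u ε : ℝ) :
    gaussianReal 0 1 {t | |c + (t - u) * w| ≤ ε * |w| ∧ c + (t - u) * w ≠ 0}
      ≤ ENNReal.ofReal (2 * ε) := by
  rcases eq_or_ne w 0 with rfl | hw
  · simp only [mul_zero, abs_zero, add_zero, abs_nonpos_iff]
    simp
  refine (gaussianReal_le_volume _).trans ?_
  have hsub : {t | |c + (t - u) * w| ≤ ε * |w| ∧ c + (t - u) * w ≠ 0}
      ⊆ Set.Icc (u - c / w - ε) (u - c / w + ε) := by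
    rintro t ⟨ht, -⟩
    have : c + (t - u) * w = (t - (u - c / w)) * w := by field_simp; ring
    rw [this, abs_mul] at ht
    have h2 := le_of_mul_le_mul_right ht (abs_pos.2 hw)
    rw [abs_le] at h2
    constructor <;> linarith [h2.1, h2.2]
  refine (measure_mono hsub).trans (le_of_eq ?_)
  rw [Real.volume_Icc]
  congr 1; ring

lemma gaussianReal_affine_zero (c w u v : ℝ) :
    gaussianReal 0 1 {t | c + (t - u) * w = 0 ∧ c + (v - u) * w ≠ 0} = 0 := by
  refine le_antisymm ((gaussianReal_le_volume _).trans (le_of_eq ?_)) bot_le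
  refine Set.Subsingleton.measure_zero ?_ _
  rintro s ⟨hs, h0⟩ t ⟨ht, -⟩
  have hw : w ≠ 0 := by
    rintro rfl
    simp at hs h0
    exact h0 hs
  have : (s - t) * w = 0 := by linarith
  have := (mul_eq_zero.1 this).resolve_right hw
  linarith

end Gaussian

/-! ### Invertibility of `Uᵀ X` and a polynomial bound on its inverse. -/

section Determinant

variable {n l : ℕ} (U : Matrix (Fin n) (Fin l) ℝ)

lemma transpose_mul_updateEntry (X : Fin n → Fin l → ℝ) (a : Fin n) (j : Fin l) (t : ℝ) :
    Uᵀ * Matrix.of (updateEntry X a j t) = (Uᵀ * Matrix.of X).updateCol j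
      ((Uᵀ * Matrix.of X).col j + (t - X a j) • U a) := by
  ext i k
  have hX : ∀ b, updateEntry X a j t b k
      = X b k + if b = a then (if k = j then t - X a j else 0) else 0 := by
    intro b
    unfold updateEntry
    by_cases hb : b = a
    · subst hb
      by_cases hk : k = j
      · subst hk; simp
      · simp [hk]
    · simp [hb]
  rw [Matrix.mul_apply]
  simp only [Matrix.of_apply, Matrix.transpose_apply, hX, mul_add, Finset.sum_add_distrib]
  rw [Matrix.updateCol_apply]
  by_cases hk : k = j
  · subst hk
    simp [Matrix.mul_apply, Matrix.col, mul_comm]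
  · simp [hk, Matrix.mul_apply]

/-- The determinant is affine in each entry of `X`, with a Cramer determinant as slope. By
`cramer_updateEntry` that slope does not depend on the entry itself, so the one-dimensional
estimates apply entry by entry. -/
lemma det_updateEntry (X : Fin n → Fin l → ℝ) (a : Fin n) (j : Fin l) (t : ℝ) :
    (Uᵀ * Matrix.of (updateEntry X a j t)).det = (Uᵀ * Matrix.of X).det
      + (t - X a j) * (Uᵀ * Matrix.of X).cramer (U a) j := by
  rw [transpose_mul_updateEntry, Matrix.det_updateCol_add, Matrix.det_updateCol_smul,
    Matrix.cramer_apply]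
  congr 2
  exact Matrix.updateCol_eq_self _ _

lemma cramer_updateEntry (X : Fin n → Fin l → ℝ) (a : Fin n) (j : Fin l) (t : ℝ) (b : Fin l → ℝ) :
    (Uᵀ * Matrix.of (updateEntry X a j t)).cramer b j = (Uᵀ * Matrix.of X).cramer b j := by
  rw [transpose_mul_updateEntry, Matrix.cramer_apply, Matrix.cramer_apply]
  simp [Matrix.updateCol_idem]

lemma continuous_det_transpose_mul :
    Continuous fun X : Fin n → Fin l → ℝ => (Uᵀ * Matrix.of X).det := by
  refine Continuous.matrix_det ?_
  exact continuous_const.matrix_mul continuous_id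

lemma continuous_cramer_transpose_mul (b : Fin l → ℝ) (j : Fin l) :
    Continuous fun X : Fin n → Fin l → ℝ => (Uᵀ * Matrix.of X).cramer b j := by
  simp_rw [Matrix.cramer_apply]
  refine Continuous.matrix_det ?_
  exact (continuous_const.matrix_mul continuous_id).matrix_updateCol j continuous_const

/-- The array that agrees with `X` on `s` and with `U` off `s`. -/
def mixEntries (s : Finset (Fin n × Fin l)) (X : Fin n → Fin l → ℝ) : Fin n → Fin l → ℝ :=
  fun a j => if (a, j) ∈ s then X a j else U a j

lemma continuous_mixEntries (s : Finset (Fin n × Fin l)) : Continuous (mixEntries U s) := by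
  refine continuous_pi fun a => continuous_pi fun j => ?_
  unfold mixEntries
  split_ifs <;> fun_prop

lemma mixEntries_insert (s : Finset (Fin n × Fin l)) (a : Fin n) (j : Fin l)
    (X : Fin n → Fin l → ℝ) :
    mixEntries U (insert (a, j) s) X = updateEntry (mixEntries U s X) a j (X a j) := by
  ext b k
  unfold mixEntries updateEntry
  by_cases hb : b = a
  · subst hb
    by_cases hk : k = j
    · subst hk; simp
    · simp [hk]
  · simp [hb]

lemma mixEntries_updateEntry (s : Finset (Fin n × Fin l)) (a : Fin n) (j : Fin l)
    (h : (a, j) ∉ s) (X : Fin n → Fin l → ℝ) (t : ℝ) :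
    mixEntries U s (updateEntry X a j t) = mixEntries U s X := by
  ext b k
  unfold mixEntries updateEntry
  by_cases hb : b = a
  · subst hb
    by_cases hk : k = j
    · subst hk; simp [h]
    · simp [hk]
  · simp [hb]

/-- Start from `X = U`, where the determinant is 1, and turn the entries Gaussian one at a time. An
affine function of the new entry that is nonzero at the old value vanishes at no more than one
point. -/
lemma gaussianBlock_det_mixEntries_eq_zero (hU : Uᵀ * U = 1) (s : Finset (Fin n × Fin l)) :
    gaussianBlock n l {X | (Uᵀ * Matrix.of (mixEntries U s X)).det = 0} = 0 := by
  induction s using Finset.induction_on with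
  | empty =>
    have : ∀ X, Matrix.of (mixEntries U ∅ X) = U := fun X => by ext; simp [mixEntries]
    simp [this, hU]
  | insert p s hp ih =>
    obtain ⟨a, j⟩ := p
    have hc : ∀ s, Continuous fun X => (Uᵀ * Matrix.of (mixEntries U s X)).det := fun s =>
      (continuous_det_transpose_mul U).comp (continuous_mixEntries U s)
    have hsub : {X | (Uᵀ * Matrix.of (mixEntries U (insert (a, j) s) X)).det = 0} ⊆
        {X | (Uᵀ * Matrix.of (mixEntries U s X)).det = 0} ∪
        {X | (Uᵀ * Matrix.of (mixEntries U (insert (a, j) s) X)).det = 0 ∧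
          (Uᵀ * Matrix.of (mixEntries U s X)).det ≠ 0} := by
      intro X hX
      by_cases h : (Uᵀ * Matrix.of (mixEntries U s X)).det = 0
      · exact Or.inl h
      · exact Or.inr ⟨hX, h⟩
    refine measure_mono_null hsub (measure_union_null ih ?_)
    refine le_antisymm (gaussianBlock_le_of_section a j ?_ fun X => le_of_eq ?_) bot_le
    · exact ((isClosed_singleton (x := (0 : ℝ))).measurableSet.preimage (hc _).measurable).inter
        ((isClosed_singleton (x := (0 : ℝ))).measurableSet.compl.preimage (hc _).measurable)
    · have h0 := gaussianReal_affine_zero (Uᵀ * Matrix.of (mixEntries U s X)).det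
        ((Uᵀ * Matrix.of (mixEntries U s X)).cramer (U a) j) (mixEntries U s X a j)
        (mixEntries U s X a j)
      convert h0 using 2
      ext t
      have ht : updateEntry X a j t a j = t := by simp [updateEntry]
      simp only [Set.mem_ofPred_eq, mixEntries_insert, mixEntries_updateEntry U s a j hp, ht,
        det_updateEntry]
      simp

lemma gaussianBlock_det_eq_zero (hU : Uᵀ * U = 1) :
    gaussianBlock n l {X | (Uᵀ * Matrix.of X).det = 0} = 0 := by
  have := gaussianBlock_det_mixEntries_eq_zero U hU Finset.univ
  have h : ∀ X, mixEntries U Finset.univ X = X := fun X => by ext; simp [mixEntries]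
  simpa [h] using this

/-- The arrays `X` for which `Uᵀ X` is invertible with a polynomially bounded inverse and whose
entries are polynomially bounded. -/
def goodBlocks (ε : ℝ) : Set (Fin n → Fin l → ℝ) :=
  {X | (Uᵀ * Matrix.of X).det ≠ 0} ∩ ⋂ p : Fin n × Fin l,
    {X | ε * |(Uᵀ * Matrix.of X).cramer (U p.1) p.2| < |(Uᵀ * Matrix.of X).det|
      ∧ |X p.1 p.2| < 1 / ε}

lemma measurableSet_goodBlocks (ε : ℝ) : MeasurableSet (goodBlocks U ε) := by
  have hd := continuous_det_transpose_mul U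
  refine IsOpen.measurableSet ?_
  refine (isOpen_ne_fun hd continuous_const).inter (isOpen_iInter_of_finite fun p => ?_)
  have hc := continuous_cramer_transpose_mul U (U p.1) p.2
  have hX : Continuous fun X : Fin n → Fin l → ℝ => |X p.1 p.2| := by fun_prop
  exact (isOpen_lt (continuous_const.mul hc.abs) hd.abs).inter (isOpen_lt hX continuous_const)

/-- Union bound over the `n * l` entries: each costs `2 * ε` for a small determinant and `ε` for the
tail. -/
lemma gaussianBlock_compl_goodBlocks_le (hU : Uᵀ * U = 1) {ε : ℝ} (hε : 0 < ε) (hε1 : ε ≤ 1) :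
    gaussianBlock n l (goodBlocks U ε)ᶜ ≤ ENNReal.ofReal (3 * n * l * ε) := by
  have hd := continuous_det_transpose_mul U
  have hsub : (goodBlocks U ε)ᶜ ⊆ {X | (Uᵀ * Matrix.of X).det = 0} ∪ ⋃ p : Fin n × Fin l,
      ({X | |(Uᵀ * Matrix.of X).det| ≤ ε * |(Uᵀ * Matrix.of X).cramer (U p.1) p.2|
        ∧ (Uᵀ * Matrix.of X).det ≠ 0} ∪ {X | 1 / ε ≤ |X p.1 p.2|}) := by
    intro X hX
    by_contra hcon
    apply hX
    simp only [Set.mem_union, Set.mem_iUnion, not_or, not_exists, Set.mem_ofPred_eq, not_and,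
      not_not] at hcon
    refine ⟨hcon.1, Set.mem_iInter.2 fun p => ⟨?_, ?_⟩⟩
    · by_contra h
      exact hcon.1 ((hcon.2 p).1 (not_lt.1 h))
    · exact not_le.1 (hcon.2 p).2
  refine (measure_mono hsub).trans ((measure_union_le _ _).trans ?_)
  rw [gaussianBlock_det_eq_zero U hU, zero_add]
  have h1 : ∀ p : Fin n × Fin l, gaussianBlock n l
      ({X | |(Uᵀ * Matrix.of X).det| ≤ ε * |(Uᵀ * Matrix.of X).cramer (U p.1) p.2|
        ∧ (Uᵀ * Matrix.of X).det ≠ 0} ∪ {X | 1 / ε ≤ |X p.1 p.2|})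
      ≤ ENNReal.ofReal (3 * ε) := by
    rintro ⟨a, j⟩
    have hc := continuous_cramer_transpose_mul U (U a) j
    refine (measure_union_le _ _).trans ?_
    rw [show 3 * ε = 2 * ε + ε by ring, ENNReal.ofReal_add (by positivity) hε.le]
    refine add_le_add (gaussianBlock_le_of_section a j ?_ fun X => ?_)
      (gaussianBlock_le_of_section a j ?_ fun X => ?_)
    · exact (measurableSet_le hd.abs.measurable
        (continuous_const.mul hc.abs).measurable).inter
        ((isClosed_singleton (x := (0 : ℝ))).measurableSet.compl.preimage hd.measurable)
    · simp only [Set.mem_ofPred_eq, det_updateEntry, cramer_updateEntry]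
      exact gaussianReal_affine_small _ _ _ _
    · exact measurableSet_le measurable_const (by fun_prop)
    · have ht : ∀ t, updateEntry X a j t a j = t := fun t => by simp [updateEntry]
      simp only [Set.mem_ofPred_eq, ht]
      exact gaussianReal_tail hε hε1
  refine (measure_iUnion_fintype_le _ _).trans ((Finset.sum_le_sum fun p _ => h1 p).trans
    (le_of_eq ?_))
  rw [Finset.sum_const, Finset.card_univ, Fintype.card_prod, Fintype.card_fin, Fintype.card_fin,
    nsmul_eq_mul, ← ENNReal.ofReal_natCast, ← ENNReal.ofReal_mul (by positivity)]
  congr 1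
  push_cast
  ring

/-- On a good block the equation `Uᵀ X y = e_i` has a polynomially bounded solution. -/
lemma exists_solution_of_mem_goodBlocks (hU : Uᵀ * U = 1) {ε : ℝ} (hε : 0 < ε)
    {X : Fin n → Fin l → ℝ} (hX : X ∈ goodBlocks U ε) (i : Fin l) :
    ∃ y : Fin l → ℝ, Uᵀ *ᵥ (Matrix.of X *ᵥ y) = Pi.single i 1 ∧
      ∀ a, |(Matrix.of X *ᵥ y) a| ≤ l * (n / ε ^ 2) := by
  set G := Uᵀ * Matrix.of X with hG
  have hdet : G.det ≠ 0 := hX.1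
  have hp : ∀ a j, ε * |G.cramer (U a) j| < |G.det| ∧ |X a j| < 1 / ε := fun a j =>
    Set.mem_iInter.1 hX.2 (a, j)
  have hU1 : ∀ a i, |U a i| ≤ 1 := by
    intro a i
    have h := congrFun (congrFun hU i) i
    simp only [Matrix.mul_apply, Matrix.transpose_apply, Matrix.one_apply_eq] at h
    rw [abs_le_one_iff_mul_self_le_one, ← h]
    exact Finset.single_le_sum (f := fun a => U a i * U a i) (fun a _ => mul_self_nonneg _)
      (Finset.mem_univ a)
  -- The good event controls the solutions only for the rows of `U` as right-hand sides; `Uᵀ U = 1`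
  -- writes `e_i` as a combination of rows with coefficients at most 1.
  have hsingle : (Pi.single i 1 : Fin l → ℝ) = ∑ a, U a i • U a := by
    ext k
    have h := congrFun (congrFun hU i) k
    simp only [Matrix.mul_apply, Matrix.transpose_apply] at h
    simp only [Finset.sum_apply, Pi.smul_apply, smul_eq_mul, h, Matrix.one_apply, Pi.single_apply,
      eq_comm]
  have hy : ∀ j, |(G.det)⁻¹ * G.cramer (Pi.single i 1) j| ≤ n / ε := by
    intro j
    have hd : 0 < |G.det| := abs_pos.2 hdet
    rw [abs_mul, abs_inv, inv_mul_le_iff₀ hd, hsingle, map_sum, Finset.sum_apply]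
    calc |∑ a, G.cramer (U a i • U a) j| ≤ ∑ a, |G.cramer (U a i • U a) j| :=
          Finset.abs_sum_le_sum_abs _ _
      _ ≤ ∑ a : Fin n, |G.det| / ε := by
          refine Finset.sum_le_sum fun a _ => ?_
          rw [map_smul, Pi.smul_apply, smul_eq_mul, abs_mul, le_div_iff₀ hε]
          have h1 := (hp a j).1
          have h2 := hU1 a i
          nlinarith [abs_nonneg (G.cramer (U a) j), mul_nonneg (abs_nonneg (G.cramer (U a) j)) hε.le]
      _ = |G.det| * (n / ε) := by
          rw [Finset.sum_const, Finset.card_univ, Fintype.card_fin, nsmul_eq_mul]; ring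
  refine ⟨fun j => (G.det)⁻¹ * G.cramer (Pi.single i 1) j, ?_, fun a => ?_⟩
  · rw [Matrix.mulVec_mulVec, ← hG]
    have : (fun j => (G.det)⁻¹ * G.cramer (Pi.single i 1) j)
        = (G.det)⁻¹ • G.cramer (Pi.single i 1) := rfl
    rw [this, Matrix.mulVec_smul, Matrix.mulVec_cramer, smul_smul, inv_mul_cancel₀ hdet, one_smul]
  · rw [Matrix.mulVec, dotProduct]
    refine (Finset.abs_sum_le_sum_abs _ _).trans ?_
    have hb : ∀ j ∈ (Finset.univ : Finset (Fin l)),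
        |Matrix.of X a j * ((G.det)⁻¹ * G.cramer (Pi.single i 1) j)| ≤ n / ε ^ 2 := by
      intro j _
      rw [abs_mul, Matrix.of_apply]
      calc _ ≤ 1 / ε * (n / ε) := by
            gcongr
            · exact (hp a j).2.le
            · exact hy j
        _ = _ := by field_simp
    refine (Finset.sum_le_card_nsmul _ _ _ hb).trans (le_of_eq ?_)
    simp

end Determinant

end BlockKrylov

namespace BlockKrylov

/-! ### Eigenvalues and singular values of a symmetric operator. -/

section Spectral

variable {E : Type*} [NormedAddCommGroup E] [InnerProductSpace ℝ E]

/-- At most `l` eigenvalues of a symmetric operator exceed `σ_{l+1}` in absolute value. -/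
lemma card_singularValues_lt_abs_eigenvalues_le [FiniteDimensional ℝ E] {T : E →ₗ[ℝ] E}
    (hT : T.IsSymmetric) {n : ℕ} (hn : Module.finrank ℝ E = n) {l : ℕ} (hl : l < n) :
    (Finset.univ.filter fun i => T.singularValues l < |hT.eigenvalues hn i|).card ≤ l := by
  have hadj : LinearMap.adjoint T = T := (LinearMap.isSymmetric_iff_isSelfAdjoint T).1 hT
  set hS := T.isSymmetric_adjoint_comp_self
  -- Singular values come from the sorted eigenvalues of `T* T`; these agree as a multiset with the
  -- squares of the eigenvalues of `T`, so both can be counted above the same threshold.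
  have hcp : (LinearMap.adjoint T ∘ₗ T).charpoly.roots
      = Multiset.map (fun i => hT.eigenvalues hn i ^ 2) Finset.univ.val := by
    have hmat : LinearMap.toMatrix (hT.eigenvectorBasis hn).toBasis
        (hT.eigenvectorBasis hn).toBasis (LinearMap.adjoint T ∘ₗ T)
        = Matrix.diagonal fun i => hT.eigenvalues hn i ^ 2 := by
      rw [hadj, LinearMap.toMatrix_comp _ (hT.eigenvectorBasis hn).toBasis,
        hT.toMatrix_eigenvectorBasis, Matrix.diagonal_mul_diagonal]
      congr 1; ext i; simp [sq]
    rw [← LinearMap.charpoly_toMatrix _ (hT.eigenvectorBasis hn).toBasis, hmat,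
      Matrix.charpoly_diagonal, Polynomial.roots_prod _ _
        (Finset.prod_ne_zero_iff.2 fun i _ => Polynomial.X_sub_C_ne_zero _)]
    simp only [Polynomial.roots_X_sub_C, Multiset.bind_singleton]
  have hcp2 := hS.roots_charpoly_eq_eigenvalues hn
  rw [hcp] at hcp2
  have hcount := congrArg (fun s => (s.filter fun x => T.singularValues l ^ 2 < x).card) hcp2
  simp only [Multiset.filter_map, Multiset.card_map] at hcount
  have hsv := T.sq_singularValues_of_lt hn hl
  calc (Finset.univ.filter fun i => T.singularValues l < |hT.eigenvalues hn i|).card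
      = (Finset.univ.filter fun i => T.singularValues l ^ 2 < hT.eigenvalues hn i ^ 2).card := by
        congr 1; ext i
        simp only [Finset.mem_filter, Finset.mem_univ, true_and]
        rw [← sq_abs (hT.eigenvalues hn i),
          sq_lt_sq₀ (T.singularValues_nonneg l) (abs_nonneg _)]
    _ = (Finset.univ.filter fun i => T.singularValues l ^ 2 < hS.eigenvalues hn i).card := hcount
    _ ≤ (Finset.univ.filter fun i : Fin n => (i : ℕ) < l).card := by
        refine Finset.card_le_card fun i hi => ?_
        simp only [Finset.mem_filter, Finset.mem_univ, true_and] at hi ⊢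
        by_contra hli
        rw [hsv] at hi
        exact absurd (hS.eigenvalues_antitone hn (show (⟨l, hl⟩ : Fin n) ≤ i from not_lt.1 hli))
          (not_le.2 hi)
    _ ≤ l := by
        rw [Fin.card_filter_val_lt]
        exact min_le_right _ _

/-- An orthonormal eigenbasis of a symmetric operator whose eigenvalues, from the index `l` on,
are bounded by `σ_{l+1}` in absolute value. -/
lemma exists_eigenbasis [FiniteDimensional ℝ E] {T : E →ₗ[ℝ] E}
    (hT : T.IsSymmetric) {n : ℕ} (hn : Module.finrank ℝ E = n) (l : ℕ) :
    ∃ (b : OrthonormalBasis (Fin n) ℝ E) (μ : Fin n → ℝ), (∀ i, T (b i) = μ i • b i) ∧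
      ∀ k : Fin n, l ≤ k → |μ k| ≤ T.singularValues l := by
  set e := hT.eigenvalues hn with he
  set p := Tuple.sort fun i => -|e i| with hp
  have hmono : Monotone ((fun i => -|e i|) ∘ p) := Tuple.monotone_sort _
  refine ⟨(hT.eigenvectorBasis hn).reindex p.symm, e ∘ p, fun i => ?_, fun k hk => ?_⟩
  · simp only [OrthonormalBasis.reindex_apply, Equiv.symm_symm, Function.comp_apply]
    exact hT.apply_eigenvectorBasis hn (p i)
  · by_contra! hcon
    have hcard := card_singularValues_lt_abs_eigenvalues_le hT hn (hk.trans_lt k.2)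
    -- A violation at `k` would spread to all `k + 1 > l` indices up to `k`, contradicting the
    -- count.
    have hsub : (Finset.Iic k).map p.toEmbedding
        ⊆ Finset.univ.filter fun i => T.singularValues l < |e i| := by
      intro i hi
      simp only [Finset.mem_map, Finset.mem_Iic, Equiv.toEmbedding_apply] at hi
      obtain ⟨j, hj, rfl⟩ := hi
      simp only [Finset.mem_filter, Finset.mem_univ, true_and]
      have := hmono hj
      simp only [Function.comp_apply] at this hcon
      linarith
    have h1 := (Finset.card_le_card hsub).trans hcard
    rw [Finset.card_map, Fin.card_Iic] at h1
    omega

end Spectral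

/-! ### Power iteration and Ritz pairs. -/

section Approximation

variable {E : Type*} [NormedAddCommGroup E] [InnerProductSpace ℝ E] {ι : Type*} [Fintype ι]
  {T : E →ₗ[ℝ] E} (hT : T.IsSymmetric) (b : OrthonormalBasis ι ℝ E) {μ : ι → ℝ}
  (hb : ∀ i, T (b i) = μ i • b i)

include hT hb

lemma inner_eigenbasis_apply (i : ι) (x : E) : inner ℝ (b i) (T x) = μ i * inner ℝ (b i) x := by
  rw [← hT, hb, inner_smul_left]; rfl

lemma inner_eigenbasis_pow_apply (i : ι) (m : ℕ) (x : E) :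
    inner ℝ (b i) ((T ^ m) x) = μ i ^ m * inner ℝ (b i) x := by
  induction m with
  | zero => simp
  | succ m ih =>
    rw [pow_succ', Module.End.mul_apply, inner_eigenbasis_apply hT b hb, ih]; ring

/-- Power iteration from `x` approximates the eigenvector `b i`, if `x` has no component along the
other dominant eigenvectors. -/
lemma norm_power_sub_eigenvector_le {τ : ℝ} {i : ι} (hi : 3 / 2 * τ < |μ i|) (hτ : 0 ≤ τ) {x : E}
    (hxi : inner ℝ (b i) x = 1) (hx : ∀ k, k ≠ i → inner ℝ (b k) x = 0 ∨ |μ k| ≤ τ) (m : ℕ) :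
    ‖(μ i ^ m)⁻¹ • (T ^ m) x - b i‖ ≤ (2 / 3) ^ m * ‖x‖ := by
  have hpos : 0 < |μ i| := lt_of_le_of_lt (by positivity) hi
  have hne : μ i ≠ 0 := abs_pos.1 hpos
  -- By Parseval it suffices to compare coordinates: the `i`-th error is zero, and each other
  -- coordinate vanishes or is scaled by `(μ k / μ i) ^ m`.
  refine le_of_sq_le_sq ?_ (by positivity)
  rw [mul_pow, ← b.sum_sq_inner_right x, ← b.sum_sq_inner_right, Finset.mul_sum]
  refine Finset.sum_le_sum fun k _ => ?_
  rw [inner_sub_right, inner_smul_right, inner_eigenbasis_pow_apply hT b hb]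
  rcases eq_or_ne k i with rfl | hk
  · rw [hxi, b.inner_eq_one, mul_one, inv_mul_cancel₀ (pow_ne_zero _ hne)]
    simp
    positivity
  · rw [b.inner_eq_zero hk, sub_zero]
    rcases hx k hk with h0 | hle
    · simp [h0]
    · rw [← mul_assoc, mul_pow]
      refine mul_le_mul_of_nonneg_right ?_ (sq_nonneg _)
      rw [← sq_abs]
      refine pow_le_pow_left₀ (abs_nonneg _) ?_ 2
      rw [← inv_pow, ← mul_pow, abs_pow]
      refine pow_le_pow_left₀ (abs_nonneg _) ?_ m
      rw [abs_mul, abs_inv, inv_mul_le_iff₀ hpos]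
      linarith

-- Here `a i` are the coordinates of a unit Ritz vector and `h0` is the Rayleigh quotient identity.
-- For `|μ i| ≤ s` all the numbers `μ i - θ` have the sign of `-θ` and size at least `γ`, so nothing
-- cancels among them. Only the terms with `|μ i| > s`, each at most `η`, can balance them, so the
-- weight on small eigenvalues is small.
omit hT hb in
lemma sum_sq_residual_le {N s γ η θ : ℝ} (a : ι → ℝ) (ha : ∑ i, a i ^ 2 = 1)
    (h0 : ∑ i, (μ i - θ) * a i ^ 2 = 0) (hη : ∀ i, s < |μ i| → |(μ i - θ) * a i| ≤ η)
    (hη0 : 0 ≤ η) (hμ : ∀ i, |μ i| ≤ N) (hθ : |θ| ≤ N) (hγ : 0 < γ) (hs : s + γ ≤ |θ|) :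
    ∑ i, ((μ i - θ) * a i) ^ 2 ≤ Fintype.card ι * (η ^ 2 + 4 * N ^ 2 / γ * η) := by
  have ha1 : ∀ i, |a i| ≤ 1 := fun i => by
    rw [← sq_le_one_iff_abs_le_one, ← ha]
    exact Finset.single_le_sum (f := fun i => a i ^ 2) (fun _ _ => sq_nonneg _) (Finset.mem_univ i)
  obtain ⟨e, he, heθ⟩ : ∃ e : ℝ, |e| = 1 ∧ e * θ = |θ| := by
    rcases le_total 0 θ with h | h
    · exact ⟨1, by simp, by simp [abs_of_nonneg h]⟩
    · exact ⟨-1, by simp, by simp [abs_of_nonpos h]⟩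
  have hc : 0 ≤ 4 * N ^ 2 / γ := by positivity
  -- The last term is a multiple of the summand in `h0`, so it disappears on summation.
  have key : ∀ i, ((μ i - θ) * a i) ^ 2
      ≤ η ^ 2 + 4 * N ^ 2 / γ * (η - e * ((μ i - θ) * a i ^ 2)) := by
    intro i
    by_cases hi : s < |μ i|
    · have h1 := hη i hi
      have h2 : ((μ i - θ) * a i) ^ 2 ≤ η ^ 2 := by
        rw [← sq_abs]; exact pow_le_pow_left₀ (abs_nonneg _) h1 2
      have h3 : e * ((μ i - θ) * a i ^ 2) ≤ η := by
        refine (le_abs_self _).trans ?_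
        rw [show e * ((μ i - θ) * a i ^ 2) = e * ((μ i - θ) * a i) * a i by ring, abs_mul, abs_mul,
          he, one_mul]
        nlinarith [abs_nonneg (a i), ha1 i, abs_nonneg ((μ i - θ) * a i)]
      nlinarith [mul_nonneg hc (sub_nonneg.2 h3)]
    · have h1 : e * μ i ≤ s := by
        refine (le_abs_self _).trans ?_
        rw [abs_mul, he, one_mul]; exact not_lt.1 hi
      have h2 : γ * a i ^ 2 ≤ -(e * ((μ i - θ) * a i ^ 2)) := by
        nlinarith [sq_nonneg (a i)]
      have h3 : ((μ i - θ) * a i) ^ 2 ≤ 4 * N ^ 2 * a i ^ 2 := by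
        rw [mul_pow]
        refine mul_le_mul_of_nonneg_right ?_ (sq_nonneg _)
        rw [← sq_abs, show 4 * N ^ 2 = (N + N) ^ 2 by ring]
        exact pow_le_pow_left₀ (abs_nonneg _) ((abs_sub _ _).trans (add_le_add (hμ i) hθ)) 2
      have h4 : 4 * N ^ 2 * a i ^ 2 = 4 * N ^ 2 / γ * (γ * a i ^ 2) := by field_simp
      have h5 := mul_le_mul_of_nonneg_left h2 hc
      have h6 := mul_nonneg hc hη0
      nlinarith [sq_nonneg η]
  refine (Finset.sum_le_sum fun i _ => key i).trans (le_of_eq ?_)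
  rw [Finset.sum_add_distrib, ← Finset.mul_sum, Finset.sum_sub_distrib, ← Finset.mul_sum, h0]
  simp
  ring

omit hT in
lemma abs_eigenvalue_le {N : ℝ} (hN : ∀ x, ‖T x‖ ≤ N * ‖x‖) (i : ι) : |μ i| ≤ N := by
  have := hN (b i)
  rwa [hb, norm_smul, b.norm_eq_one, mul_one, mul_one, Real.norm_eq_abs] at this

omit hT hb in
lemma abs_inner_le_of_near {K : Submodule ℝ E} {u r w : E} {δ : ℝ} (hw : w ∈ K)
    (hδ : ‖w - u‖ ≤ δ) (hr : ∀ w ∈ K, inner ℝ w r = 0) : |inner ℝ u r| ≤ δ * ‖r‖ := by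
  have : inner ℝ u r = -inner ℝ (w - u) r := by rw [inner_sub_left, hr w hw]; ring
  rw [this, abs_neg]
  exact (abs_real_inner_le_norm _ _).trans (mul_le_mul_of_nonneg_right hδ (norm_nonneg _))

-- Pythagoras: the residual is orthogonal to `z`, so `T z` splits into the residual and `θ • z`.
omit hT hb in
lemma ritz_bounds {N θ : ℝ} (hN : ∀ x, ‖T x‖ ≤ N * ‖x‖) {z : E} (hz : ‖z‖ = 1)
    (hr : inner ℝ z (T z - θ • z) = 0) : ‖T z - θ • z‖ ≤ N ∧ |θ| ≤ N := by
  have h1 : ‖T z‖ ^ 2 = ‖T z - θ • z‖ ^ 2 + θ ^ 2 := by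
    have h : T z = (T z - θ • z) + θ • z := by abel
    nth_rewrite 1 [h]
    rw [norm_add_sq_real, inner_smul_right, real_inner_comm, hr, norm_smul, hz, mul_one,
      Real.norm_eq_abs, sq_abs]
    ring
  have h2 := hN z
  rw [hz, mul_one] at h2
  have h0 := norm_nonneg (T z)
  constructor
  · nlinarith [norm_nonneg (T z - θ • z), sq_nonneg θ]
  · refine abs_le_of_sq_le_sq ?_ (h0.trans h2)
    nlinarith [sq_nonneg ‖T z - θ • z‖]

/-- A Ritz pair whose Ritz value exceeds `s` by a margin `γ` has a small residual, if all
eigenvectors with an eigenvalue exceeding `s` are close to the subspace. -/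
lemma sq_norm_residual_le {N s γ δ θ : ℝ} (hN : ∀ x, ‖T x‖ ≤ N * ‖x‖) (hN0 : 0 ≤ N) (hδ : 0 ≤ δ)
    {K : Submodule ℝ E} (hK : ∀ i, s < |μ i| → ∃ w ∈ K, ‖w - b i‖ ≤ δ) {z : E} (hzK : z ∈ K)
    (hz : ‖z‖ = 1) (hr : ∀ w ∈ K, inner ℝ w (T z - θ • z) = 0) (hγ : 0 < γ) (hs : s + γ ≤ |θ|) :
    ‖T z - θ • z‖ ^ 2
      ≤ Fintype.card ι * ((δ * N) ^ 2 + 4 * N ^ 2 / γ * (δ * N)) := by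
  obtain ⟨hrN, hθ⟩ := ritz_bounds hN hz (hr z hzK)
  have hc : ∀ i, inner ℝ (b i) (T z - θ • z) = (μ i - θ) * inner ℝ (b i) z := fun i => by
    rw [inner_sub_right, inner_smul_right, inner_eigenbasis_apply hT b hb]; ring
  rw [← b.sum_sq_inner_right (T z - θ • z)]
  simp_rw [hc]
  refine sum_sq_residual_le (s := s) (fun i => inner ℝ (b i) z) ?_ ?_ ?_ (by positivity)
    (abs_eigenvalue_le b hb hN) hθ hγ hs
  · rw [b.sum_sq_inner_right, hz, one_pow]
  · have h := hr z hzK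
    rw [← b.sum_inner_mul_inner] at h
    rw [← h]
    refine Finset.sum_congr rfl fun i _ => ?_
    rw [hc, real_inner_comm]; ring
  · intro i hi
    obtain ⟨w, hw, hwδ⟩ := hK i hi
    rw [← hc]
    exact (abs_inner_le_of_near hw hwδ hr).trans (mul_le_mul_of_nonneg_left hrN hδ)

/-- A Ritz vector is almost orthogonal to the eigenvectors that are close to the subspace and whose
eigenvalue is separated from the Ritz value. -/
lemma abs_inner_ritz_le {N γ δ θ : ℝ} (hN : ∀ x, ‖T x‖ ≤ N * ‖x‖) (hδ : 0 ≤ δ)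
    {K : Submodule ℝ E} {i : ι} (hK : ∃ w ∈ K, ‖w - b i‖ ≤ δ) {z : E} (hzK : z ∈ K)
    (hz : ‖z‖ = 1) (hr : ∀ w ∈ K, inner ℝ w (T z - θ • z) = 0) (hγ : 0 < γ)
    (hs : γ ≤ |μ i - θ|) : |inner ℝ z (b i)| ≤ δ * N / γ := by
  obtain ⟨w, hw, hwδ⟩ := hK
  have hc : inner ℝ (b i) (T z - θ • z) = (μ i - θ) * inner ℝ (b i) z := by
    rw [inner_sub_right, inner_smul_right, inner_eigenbasis_apply hT b hb]; ring
  have h := (abs_inner_le_of_near hw hwδ hr).trans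
    (mul_le_mul_of_nonneg_left (ritz_bounds hN hz (hr z hzK)).1 hδ)
  rw [hc, abs_mul] at h
  rw [le_div_iff₀ hγ, real_inner_comm]
  nlinarith [abs_nonneg (inner ℝ (b i) z)]

omit hT hb

/-! ### The projection that removes a set of orthonormal vectors. -/

section Deflation

variable {κ : Type*} {z : κ → E} (hz : Orthonormal ℝ z) (S : Finset κ)
  {P : E →ₗ[ℝ] E} (hP : ∀ x, P x = x - ∑ j ∈ S, inner ℝ (z j) x • z j)

include hP

lemma inner_deflation_left (x y : E) : inner ℝ (P x) y = inner ℝ x (P y) := by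
  rw [hP, hP, inner_sub_left, inner_sub_right, sum_inner, inner_sum]
  congr 1
  refine Finset.sum_congr rfl fun j _ => ?_
  rw [inner_smul_left, inner_smul_right, real_inner_comm x (z j)]
  simp [mul_comm]

include hz

lemma norm_deflation_le (x : E) : ‖P x‖ ≤ ‖x‖ := by
  have horth : ∀ j ∈ S, inner ℝ (P x) (z j) = 0 := by
    intro j hj
    rw [hP, inner_sub_left, real_inner_comm, hz.inner_left_sum _ hj]
    simp
  have h : ‖P x‖ ^ 2 = inner ℝ (P x) x := by
    rw [← real_inner_self_eq_norm_sq]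
    nth_rewrite 2 [hP]
    rw [inner_sub_right, inner_sum, Finset.sum_eq_zero, sub_zero]
    intro j hj
    rw [inner_smul_right, horth j hj, mul_zero]
  have h2 := real_inner_le_norm (P x) x
  nlinarith [norm_nonneg (P x), norm_nonneg x]

variable [Fintype κ] [DecidableEq κ]

/-- `P u` is the part of `u` orthogonal to the whole span, no longer than `w - u`, plus the
components along the `z j` that were not removed. -/
lemma norm_deflation_le_of_near {u w : E} {δ c : ℝ} (hw : w ∈ Submodule.span ℝ (Set.range z))
    (hδ : ‖w - u‖ ≤ δ) (hc0 : 0 ≤ c) (hc : ∀ j ∉ S, |inner ℝ (z j) u| ≤ c) :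
    ‖P u‖ ≤ δ + Fintype.card κ * c := by
  set y := u - ∑ j, inner ℝ (z j) u • z j with hy
  have horth : ∀ j, inner ℝ y (z j) = 0 := by
    intro j
    rw [hy, inner_sub_left, real_inner_comm, hz.inner_left_sum _ (Finset.mem_univ j)]
    simp
  have hyw : inner ℝ y w = 0 := by
    clear hδ
    induction hw using Submodule.span_induction with
    | mem v hv => obtain ⟨j, rfl⟩ := hv; exact horth j
    | zero => simp
    | add v v' _ _ h h' => rw [inner_add_right, h, h', add_zero]
    | smul a v _ h => rw [inner_smul_right, h, mul_zero]
  have hyn : ‖y‖ ≤ δ := by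
    have h : ‖y‖ ^ 2 = -inner ℝ y (w - u) := by
      rw [← real_inner_self_eq_norm_sq, inner_sub_right y w u, hyw]
      nth_rewrite 2 [hy]
      rw [inner_sub_right, inner_sum, Finset.sum_eq_zero]
      · ring
      · intro j _
        rw [inner_smul_right, horth j, mul_zero]
    have h2 := abs_real_inner_le_norm y (w - u)
    have h3 := neg_le_abs (inner ℝ y (w - u))
    rcases (norm_nonneg y).eq_or_lt with h0 | h0
    · rw [← h0]; exact (norm_nonneg _).trans hδ
    · nlinarith
  have hPu : P u = y + ∑ j ∈ Sᶜ, inner ℝ (z j) u • z j := by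
    rw [hP, hy, ← Finset.sum_add_sum_compl S]; abel
  rw [hPu]
  refine (norm_add_le _ _).trans (add_le_add hyn ((norm_sum_le _ _).trans ?_))
  calc ∑ j ∈ Sᶜ, ‖inner ℝ (z j) u • z j‖ ≤ ∑ j ∈ Sᶜ, c := by
        refine Finset.sum_le_sum fun j hj => ?_
        rw [norm_smul, hz.1 j, mul_one]
        exact hc j (Finset.mem_compl.1 hj)
    _ ≤ Fintype.card κ * c := by
        rw [Finset.sum_const, nsmul_eq_mul]
        gcongr
        exact Finset.card_le_univ _

omit [Fintype κ] [DecidableEq κ]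

include hT hb

/-- Expand `T (P x)` in the eigenbasis. Small eigenvalues contribute at most `t * ‖P x‖`; for large
ones self-adjointness moves `P` onto `b i`, where it is nearly zero. -/
lemma norm_deflation_comp_le {N t c : ℝ} (hN : ∀ x, ‖T x‖ ≤ N * ‖x‖) (hN0 : 0 ≤ N) (ht : 0 ≤ t)
    (hc0 : 0 ≤ c) (hc : ∀ i, t < |μ i| → ‖P (b i)‖ ≤ c) (x : E) :
    ‖P (T (P x))‖ ≤ (t + Fintype.card ι * (N * c)) * ‖x‖ := by
  refine (norm_deflation_le hz S hP _).trans ?_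
  refine le_of_sq_le_sq ?_ (by positivity)
  rw [← b.sum_sq_inner_right]
  have key : ∀ i, inner ℝ (b i) (T (P x)) ^ 2
      ≤ t ^ 2 * inner ℝ (b i) (P x) ^ 2 + (N * c * ‖x‖) ^ 2 := by
    intro i
    rw [inner_eigenbasis_apply hT b hb, mul_pow]
    by_cases hi : t < |μ i|
    · have h1 : |inner ℝ (b i) (P x)| ≤ c * ‖x‖ := by
        rw [← inner_deflation_left S hP]
        exact (abs_real_inner_le_norm _ _).trans
          (mul_le_mul_of_nonneg_right (hc i hi) (norm_nonneg _))
      have h2 : (μ i) ^ 2 * inner ℝ (b i) (P x) ^ 2 ≤ (N * c * ‖x‖) ^ 2 := by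
        rw [← mul_pow, ← sq_abs, abs_mul, mul_assoc]
        exact pow_le_pow_left₀ (by positivity)
          (mul_le_mul (abs_eigenvalue_le b hb hN i) h1 (abs_nonneg _) hN0) 2
      nlinarith [mul_nonneg (sq_nonneg t) (sq_nonneg (inner ℝ (b i) (P x)))]
    · have : μ i ^ 2 ≤ t ^ 2 := by
        rw [← sq_abs]; exact pow_le_pow_left₀ (abs_nonneg _) (not_lt.1 hi) 2
      nlinarith [sq_nonneg (inner ℝ (b i) (P x)), sq_nonneg (N * c * ‖x‖)]
  refine (Finset.sum_le_sum fun i _ => key i).trans ?_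
  rw [Finset.sum_add_distrib, ← Finset.mul_sum, b.sum_sq_inner_right, Finset.sum_const,
    Finset.card_univ, nsmul_eq_mul]
  have hPx := pow_le_pow_left₀ (norm_nonneg _) (norm_deflation_le hz S hP x) 2
  have hcard : (Fintype.card ι : ℝ) ≤ (Fintype.card ι : ℝ) ^ 2 := by
    exact_mod_cast Nat.le_self_pow two_ne_zero _
  have h1 : t ^ 2 * ‖P x‖ ^ 2 ≤ t ^ 2 * ‖x‖ ^ 2 := by gcongr
  have h2 : Fintype.card ι * (N * c * ‖x‖) ^ 2 ≤ (Fintype.card ι : ℝ) ^ 2 * (N * c * ‖x‖) ^ 2 := by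
    gcongr
  have h3 : 0 ≤ t * (Fintype.card ι * (N * c)) * ‖x‖ ^ 2 := by positivity
  nlinarith

end Deflation

/-- **Deflation by converged Ritz vectors.** `z` is an orthonormal system of Ritz vectors of `T`
with Ritz values `θ`, all eigenvectors of `T` with an eigenvalue above `3τ/2` are `δ`-close to the
span of `z`, and `S` contains all Ritz vectors with a residual of at most `ρ`. -/
theorem norm_deflation_comp_le_of_ritz {κ : Type*} [Fintype κ] [DecidableEq κ] {z : κ → E}
    (hT : T.IsSymmetric) (hb : ∀ i, T (b i) = μ i • b i) (hz : Orthonormal ℝ z) (S : Finset κ)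
    {P : E →ₗ[ℝ] E} (hP : ∀ x, P x = x - ∑ j ∈ S, inner ℝ (z j) x • z j) {θ : κ → ℝ}
    (hr : ∀ j, ∀ w ∈ Submodule.span ℝ (Set.range z), inner ℝ w (T (z j) - θ j • z j) = 0)
    {N τ γ δ ρ : ℝ} (hN : ∀ x, ‖T x‖ ≤ N * ‖x‖) (hN0 : 0 ≤ N) (hτ : 0 ≤ τ) (hγ : 0 < γ)
    (hδ : 0 ≤ δ) (hρ0 : 0 ≤ ρ)
    (hK : ∀ i, 3 / 2 * τ < |μ i| → ∃ w ∈ Submodule.span ℝ (Set.range z), ‖w - b i‖ ≤ δ)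
    (hS : ∀ j ∉ S, ρ < ‖T (z j) - θ j • z j‖)
    (hρ : Fintype.card ι * ((δ * N) ^ 2 + 4 * N ^ 2 / γ * (δ * N)) ≤ ρ ^ 2) (x : E) :
    ‖P (T (P x))‖ ≤ (2 * τ + 2 * γ
      + Fintype.card ι * (N * (δ + Fintype.card ι * (δ * N / γ)))) * ‖x‖ := by
  have hzK : ∀ j, z j ∈ Submodule.span ℝ (Set.range z) := fun j =>
    Submodule.subset_span (Set.mem_range_self j)
  -- A larger Ritz value would force the residual below `ρ` and put `j` in `S`.
  have hθ : ∀ j ∉ S, |θ j| < 3 / 2 * τ + γ := by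
    intro j hj
    by_contra! hcon
    have h := (sq_norm_residual_le hT b hb hN hN0 hδ hK (hzK j) (hz.1 j) (hr j) hγ hcon).trans hρ
    exact absurd (abs_le_of_sq_le_sq h hρ0) (not_le.2 ((hS j hj).trans_le (le_abs_self _)))
  have hcard : (Fintype.card κ : ℝ) ≤ Fintype.card ι := by
    have : Module.Finite ℝ E := b.toBasis.finiteDimensional_of_finite
    have h := hz.linearIndependent.fintype_card_le_finrank
    rw [Module.finrank_eq_card_basis b.toBasis] at h
    exact_mod_cast h
  -- The threshold is `t = 2τ + 2γ`. It exceeds the bound on discarded Ritz values by `τ/2 + γ`, so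
  -- the gap `γ` survives even when `τ = 0`.
  refine norm_deflation_comp_le hT b hb hz S hP hN hN0 (by positivity) (by positivity)
    (fun i hi => ?_) x
  obtain ⟨w, hw, hwδ⟩ := hK i (by linarith)
  refine (norm_deflation_le_of_near hz S hP hw hwδ (c := δ * N / γ) (by positivity)
    fun j hj => ?_).trans ?_
  · refine abs_inner_ritz_le hT b hb hN hδ ⟨w, hw, hwδ⟩ (hzK j) (hz.1 j) (hr j) hγ ?_
    have h1 := hθ j hj
    have h2 := abs_sub_abs_le_abs_sub (μ i) (θ j)
    linarith
  · gcongr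

end Approximation

end BlockKrylov

namespace BlockKrylov

/-! ### From matrices to operators: Ritz vectors of a run. -/

section Runs

variable {n l : ℕ}

lemma inner_toLp (x y : Fin n → ℝ) :
    inner ℝ (WithLp.toLp 2 x : EuclideanSpace ℝ (Fin n)) (WithLp.toLp 2 y) = x ⬝ᵥ y := by
  rw [EuclideanSpace.inner_toLp_toLp, dotProduct_comm]; simp

lemma toEuclideanLin_pow_toLp (A : Matrix (Fin n) (Fin n) ℝ) (m : ℕ) (x : Fin n → ℝ) :
    (Matrix.toEuclideanLin A ^ m) (WithLp.toLp 2 x) = WithLp.toLp 2 ((A ^ m) *ᵥ x) := by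
  induction m with
  | zero => simp
  | succ m ih =>
    rw [pow_succ', Module.End.mul_apply, ih, pow_succ', ← Matrix.mulVec_mulVec]
    rfl

lemma toEuclideanLin_isSymmetric {A : Matrix (Fin n) (Fin n) ℝ} (hA : A.IsSymm) :
    (Matrix.toEuclideanLin A).IsSymmetric := by
  rw [Matrix.isSymmetric_toEuclideanLin_iff, Matrix.IsHermitian,
    Matrix.conjTranspose_eq_transpose_of_trivial]
  exact hA

lemma norm_toEuclideanLin_le (A : Matrix (Fin n) (Fin n) ℝ) (x : EuclideanSpace ℝ (Fin n)) :
    ‖Matrix.toEuclideanLin A x‖ ≤ ‖A‖ * ‖x‖ :=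
  A.l2_opNorm_mulVec x

lemma norm_toLp_le {x : Fin n → ℝ} {B : ℝ} (hB : 0 ≤ B) (hx : ∀ a, |x a| ≤ B) :
    ‖(WithLp.toLp 2 x : EuclideanSpace ℝ (Fin n))‖ ≤ n * B := by
  refine le_of_sq_le_sq ?_ (by positivity)
  rw [EuclideanSpace.real_norm_sq_eq]
  calc ∑ a, x a ^ 2 ≤ ∑ _a : Fin n, B ^ 2 := Finset.sum_le_sum fun a _ => by
        rw [← sq_abs]; exact pow_le_pow_left₀ (abs_nonneg _) (hx a) 2
    _ = n * B ^ 2 := by simp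
    _ ≤ (n : ℝ) ^ 2 * B ^ 2 := by
        gcongr
        exact_mod_cast Nat.le_self_pow two_ne_zero n
    _ = (n * B) ^ 2 := by ring

lemma krylov_mulVec_mem_range {A : Matrix (Fin n) (Fin n) ℝ} (hA : A.IsSymm)
    (X : Matrix (Fin n) (Fin l) ℝ) (q : ℕ) (y : Fin l → ℝ) :
    (A ^ (2 * q + 1)) *ᵥ (X *ᵥ y) ∈ LinearMap.range (krylovMatrix A X q).mulVecLin := by
  have hpow : (A * Aᵀ) ^ q * (A * X) = A ^ (2 * q + 1) * X := by
    rw [hA.eq, ← sq, ← pow_mul, ← Matrix.mul_assoc, ← pow_succ]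
  -- Only the last Krylov block is needed: for symmetric `A` it equals `A ^ (2q+1) X`.
  refine ⟨fun jb => if jb.1 = Fin.last q then y jb.2 else 0, ?_⟩
  ext a
  rw [Matrix.mulVecLin_apply, Matrix.mulVec_mulVec, Matrix.mulVec, dotProduct,
    Fintype.sum_prod_type, Finset.sum_eq_single (Fin.last q)]
  · simp only [krylovMatrix, Matrix.of_apply, if_true, Fin.val_last]
    exact congrArg (fun M => (M *ᵥ y) a) hpow
  · intro k _ hk
    simp [hk]
  · simp

variable {A : Matrix (Fin n) (Fin n) ℝ} {X : Matrix (Fin n) (Fin l) ℝ} {q : ℕ}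

namespace Run

/-- The Ritz vectors `Q v_j` of a run. -/
noncomputable def ritz (R : Run A X q) (j : Fin R.r) : EuclideanSpace ℝ (Fin n) :=
  WithLp.toLp 2 (R.Q *ᵥ R.V.col j)

lemma dotProduct_mulVec_Q (R : Run A X q) (u v : Fin R.r → ℝ) :
    (R.Q *ᵥ u) ⬝ᵥ (R.Q *ᵥ v) = u ⬝ᵥ v := by
  rw [Matrix.dotProduct_mulVec, Matrix.vecMul_mulVec, ← Matrix.dotProduct_mulVec]
  simp [R.orthonormal_Q]

lemma dotProduct_V_col (R : Run A X q) (j k : Fin R.r) :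
    R.V.col j ⬝ᵥ R.V.col k = if j = k then 1 else 0 := by
  have h := congrFun (congrFun R.orthonormal_V j) k
  rw [Matrix.one_apply] at h
  rw [← h]
  rfl

lemma orthonormal_ritz (R : Run A X q) : Orthonormal ℝ R.ritz := by
  rw [orthonormal_iff_ite]
  intro j k
  rw [ritz, ritz, inner_toLp, dotProduct_mulVec_Q, dotProduct_V_col]

lemma mem_span_ritz (R : Run A X q) {v : Fin n → ℝ}
    (hv : v ∈ LinearMap.range (krylovMatrix A X q).mulVecLin) :
    (WithLp.toLp 2 v : EuclideanSpace ℝ (Fin n)) ∈ Submodule.span ℝ (Set.range R.ritz) := by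
  rw [← R.range_Q] at hv
  obtain ⟨y, rfl⟩ := hv
  have hV : R.V * R.Vᵀ = 1 := mul_eq_one_comm.1 R.orthonormal_V
  have hy : R.Q.mulVecLin y = ∑ j, (R.Vᵀ *ᵥ y) j • (R.Q *ᵥ R.V.col j) := by
    have h : R.Q *ᵥ y = (R.Q * R.V) *ᵥ (R.Vᵀ *ᵥ y) := by
      rw [Matrix.mulVec_mulVec, Matrix.mul_assoc, hV, Matrix.mul_one]
    rw [Matrix.mulVecLin_apply, h, Matrix.mulVec_eq_sum]
    refine Finset.sum_congr rfl fun j _ => ?_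
    rw [op_smul_eq_smul]
    rfl
  rw [hy, WithLp.toLp_sum]
  refine Submodule.sum_mem _ fun j _ => ?_
  rw [WithLp.toLp_smul]
  exact Submodule.smul_mem _ _ (Submodule.subset_span ⟨j, rfl⟩)

/-- Galerkin condition: compressing the residual by `Qᵀ` gives the eigenvector equation of `Qᵀ A Q`.
-/
lemma inner_residual_eq_zero (R : Run A X q) (j : Fin R.r) {w : EuclideanSpace ℝ (Fin n)}
    (hw : w ∈ Submodule.span ℝ (Set.range R.ritz)) :
    inner ℝ w (Matrix.toEuclideanLin A (R.ritz j) - R.lam j • R.ritz j) = 0 := by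
  have hz : ∀ k, inner ℝ (R.ritz k) (Matrix.toEuclideanLin A (R.ritz j) - R.lam j • R.ritz j)
      = 0 := by
    intro k
    have hT : Matrix.toEuclideanLin A (R.ritz j) = WithLp.toLp 2 (A *ᵥ (R.Q *ᵥ R.V.col j)) := rfl
    have hA : (R.Q *ᵥ R.V.col k) ⬝ᵥ (A *ᵥ (R.Q *ᵥ R.V.col j))
        = R.lam j * (R.V.col k ⬝ᵥ R.V.col j) := by
      rw [← smul_eq_mul, ← dotProduct_smul, ← R.eigen j, ← Matrix.vecMul_transpose,
        ← Matrix.dotProduct_mulVec, Matrix.mulVec_mulVec, Matrix.mulVec_mulVec, Matrix.mul_assoc]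
    rw [inner_sub_right, inner_smul_right, hT, ritz, ritz, inner_toLp, inner_toLp, hA,
      dotProduct_mulVec_Q, sub_self]
  induction hw using Submodule.span_induction with
  | mem v hv => obtain ⟨k, rfl⟩ := hv; exact hz k
  | zero => simp
  | add v v' _ _ h h' => rw [inner_add_left, h, h', add_zero]
  | smul a v _ h => rw [inner_smul_left, h, mul_zero]

open Classical in
lemma toEuclideanLin_P (R : Run A X q) (β : ℝ) (x : EuclideanSpace ℝ (Fin n)) :
    Matrix.toEuclideanLin (R.P β) x
      = x - ∑ j ∈ Finset.univ.filter (· ∈ R.converged β), inner ℝ (R.ritz j) x • R.ritz j := by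
  have hsum : ∑ j ∈ Finset.univ.filter (· ∈ R.converged β), inner ℝ (R.ritz j) x • R.ritz j
      = ∑ j : R.converged β, inner ℝ (R.ritz j) x • R.ritz j := by
    rw [Finset.sum_subtype (p := (· ∈ R.converged β)) _ (by simp)]
  rw [hsum]
  ext a
  have hin : ∀ j, inner ℝ (R.ritz j) x = (R.Q *ᵥ R.V.col j) ⬝ᵥ x.ofLp := fun j =>
    inner_toLp _ _
  change (R.P β *ᵥ x.ofLp) a = _
  rw [P, Matrix.sub_mulVec, Matrix.one_mulVec, ← Matrix.mulVec_mulVec, Pi.sub_apply]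
  simp only [PiLp.sub_apply, WithLp.ofLp_sum, Finset.sum_apply, PiLp.smul_apply, smul_eq_mul, hin]
  refine congrArg (x.ofLp a - ·) ?_
  change ∑ j, R.Z β a j * ((R.Z β)ᵀ *ᵥ x.ofLp) j = _
  exact Finset.sum_congr rfl fun j _ => mul_comm _ _

open Classical in
/-- The deflation bound for a run on a good block. -/
theorem norm_P_mul_mul_P_le (R : Run A X q) (hA : A.IsSymm) (hln : l ≤ n) {β ε γ δ : ℝ}
    {b : OrthonormalBasis (Fin n) ℝ (EuclideanSpace ℝ (Fin n))} {μ : Fin n → ℝ}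
    (hb : ∀ i, Matrix.toEuclideanLin A (b i) = μ i • b i)
    (hμ : ∀ k : Fin n, l ≤ k → |μ k| ≤ sigma A l) (hε : 0 < ε) (hγ : 0 < γ)
    (hX : (X : Fin n → Fin l → ℝ)
      ∈ goodBlocks (Matrix.of fun a (i : Fin l) => b (Fin.castLE hln i) a) ε)
    (hδ : (2 / 3) ^ (2 * q + 1) * (n * (l * (n / ε ^ 2))) ≤ δ)
    (hρ : n * ((δ * ‖A‖) ^ 2 + 4 * ‖A‖ ^ 2 / γ * (δ * ‖A‖)) ≤ (‖A‖ / (n : ℝ) ^ β) ^ 2) :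
    ‖R.P β * A * R.P β‖
      ≤ 2 * sigma A l + 2 * γ + n * (‖A‖ * (δ + n * (δ * ‖A‖ / γ))) := by
  set U : Matrix (Fin n) (Fin l) ℝ := Matrix.of fun a (i : Fin l) => b (Fin.castLE hln i) a
  have hinner : ∀ (i : Fin l) (x : Fin n → ℝ),
      inner ℝ (b (Fin.castLE hln i)) (WithLp.toLp 2 x) = (Uᵀ *ᵥ x) i := fun i x =>
    inner_toLp (b (Fin.castLE hln i)).ofLp x
  have hUU : Uᵀ * U = 1 := by
    ext i k
    have h := orthonormal_iff_ite.1 b.orthonormal (Fin.castLE hln i) (Fin.castLE hln k)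
    rw [Matrix.one_apply]
    simp only [Fin.castLE_inj] at h
    rw [← h]
    exact (hinner i (b (Fin.castLE hln k)).ofLp).symm
  have hT := toEuclideanLin_isSymmetric hA
  have hτ : 0 ≤ sigma A l := LinearMap.singularValues_nonneg _ _
  have hδ0 : 0 ≤ δ := le_trans (by positivity) hδ
  have hK : ∀ i, 3 / 2 * sigma A l < |μ i| →
      ∃ w ∈ Submodule.span ℝ (Set.range R.ritz), ‖w - b i‖ ≤ δ := by
    intro i hi
    have hil : (i : ℕ) < l := by
      by_contra h
      linarith [hμ i (not_lt.1 h)]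
    obtain ⟨y, hy, hyn⟩ := exists_solution_of_mem_goodBlocks U hUU hε hX ⟨i, hil⟩
    -- Power iteration from `X y`, whose coordinates along the first `l` eigenvectors are those of
    -- `e_i`.
    refine ⟨(μ i ^ (2 * q + 1))⁻¹ • (Matrix.toEuclideanLin A ^ (2 * q + 1))
      (WithLp.toLp 2 (X *ᵥ y)), Submodule.smul_mem _ _ ?_, ?_⟩
    · rw [toEuclideanLin_pow_toLp]
      exact R.mem_span_ritz (krylov_mulVec_mem_range hA X q y)
    · refine (norm_power_sub_eigenvector_le hT b hb hi hτ ?_ ?_ _).trans (le_trans ?_ hδ)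
      · have h := hinner ⟨i, hil⟩ (X *ᵥ y)
        rw [show Uᵀ *ᵥ (X *ᵥ y) = _ from hy, Pi.single_eq_same] at h
        exact h
      · intro k hki
        by_cases hk : (k : ℕ) < l
        · left
          have h := hinner ⟨k, hk⟩ (X *ᵥ y)
          rw [show Uᵀ *ᵥ (X *ᵥ y) = _ from hy, Pi.single_eq_of_ne] at h
          · exact h
          · intro h'
            exact hki (Fin.ext (Fin.mk.inj_iff.1 h'))
        · exact Or.inr (hμ k (not_lt.1 hk))
      · exact mul_le_mul_of_nonneg_left (norm_toLp_le (by positivity) hyn) (by positivity)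
  rw [Matrix.l2_opNorm_def]
  refine ContinuousLinearMap.opNorm_le_bound _ (by positivity) fun x => ?_
  have hPAP : (Matrix.toEuclideanLin.trans LinearMap.toContinuousLinearMap) (R.P β * A * R.P β) x
      = Matrix.toEuclideanLin (R.P β) (Matrix.toEuclideanLin A
        (Matrix.toEuclideanLin (R.P β) x)) := by
    change WithLp.toLp 2 ((R.P β * A * R.P β) *ᵥ x.ofLp)
      = WithLp.toLp 2 (R.P β *ᵥ (A *ᵥ (R.P β *ᵥ x.ofLp)))
    rw [Matrix.mulVec_mulVec, Matrix.mulVec_mulVec]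
  rw [hPAP]
  have main := norm_deflation_comp_le_of_ritz b hT hb R.orthonormal_ritz
    (Finset.univ.filter (· ∈ R.converged β)) (R.toEuclideanLin_P β)
    (fun j w hw => R.inner_residual_eq_zero j hw) (norm_toEuclideanLin_le A) (norm_nonneg A) hτ hγ
    hδ0 (ρ := ‖A‖ / (n : ℝ) ^ β) (by positivity) hK
    (fun j hj => not_le.1 fun h => hj (Finset.mem_filter.2 ⟨Finset.mem_univ j, h⟩))
    (by simpa using hρ) x
  simpa using main

end Run

end Runs

/-! ### Choice of the polynomial scales. -/

section Numerics

lemma two_thirds_pow_mul_rpow_le {n : ℝ} (hn : 2 ≤ n) {a d : ℝ} {q : ℕ}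
    (hq : 2 * (a + d) * Real.log n ≤ q) :
    (2 / 3 : ℝ) ^ (2 * q + 1) * n ^ a ≤ n ^ (-d) := by
  have hn0 : 0 < n := by linarith
  have h1 : (2 / 3 : ℝ) ≤ Real.exp (-(1 / 3)) := by
    linarith [Real.add_one_le_exp (-(1 / 3 : ℝ))]
  have h2 : (2 / 3 : ℝ) ^ (2 * q + 1) ≤ Real.exp (-((2 * q + 1) / 3)) := by
    refine (pow_le_pow_left₀ (by norm_num) h1 _).trans (le_of_eq ?_)
    rw [← Real.exp_nat_mul]
    congr 1; push_cast; ring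
  refine (mul_le_mul_of_nonneg_right h2 (by positivity)).trans ?_
  rw [Real.rpow_def_of_pos hn0, Real.rpow_def_of_pos hn0, ← Real.exp_add, Real.exp_le_exp]
  have hq0 : (0 : ℝ) ≤ q := Nat.cast_nonneg q
  linarith

lemma residual_tolerance_le {n p e δ N : ℝ} (hn : 2 ≤ n) (hp : 0 < p) (hp1 : p ≤ 1) (he : 0 < e)
    (he1 : e ≤ 1) (hδ : δ ≤ p ^ 2 * e / n ^ 6) (hδ0 : 0 ≤ δ) (hN : 0 < N) :
    n * ((δ * N) ^ 2 + 4 * N ^ 2 / (N * (p / n ^ 2)) * (δ * N)) ≤ N ^ 2 * e := by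
  have hn0 : 0 < n := by linarith
  have h3 : 8 ≤ n ^ 3 := by
    calc (8 : ℝ) = 2 ^ 3 := by norm_num
      _ ≤ n ^ 3 := by gcongr
  have hδ' : δ * n ^ 6 ≤ p ^ 2 * e := by rwa [le_div_iff₀ (by positivity)] at hδ
  have h6 : n * 2 ≤ n ^ 6 := by
    calc n * 2 ≤ n * n ^ 5 := by
          gcongr
          exact hn.trans (le_self_pow₀ (by linarith) (by norm_num))
      _ = n ^ 6 := by ring
  have hp2 : p ^ 2 ≤ 1 := pow_le_one₀ hp.le hp1
  have hpe : p ^ 2 * e ≤ e := mul_le_of_le_one_left he.le hp2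
  have hδ1 : δ ≤ 1 := by nlinarith
  have hA : n * δ ^ 2 ≤ e / 2 := by
    have : n * 2 * δ ≤ e := by nlinarith
    nlinarith [mul_nonneg hn0.le hδ0]
  have hB : n * (4 * (n ^ 2 / p) * δ) ≤ e / 2 := by
    rw [show n * (4 * (n ^ 2 / p) * δ) = 4 * (n ^ 3 * δ) / p by ring, div_le_iff₀ hp]
    have h5 : n ^ 3 * δ * 8 ≤ n ^ 6 * δ := by
      rw [show n ^ 6 * δ = n ^ 3 * δ * n ^ 3 by ring]
      exact mul_le_mul_of_nonneg_left h3 (by positivity)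
    have h7 : p ^ 2 * e ≤ p * e := by nlinarith [mul_pos hp he]
    linarith
  have hid : n * ((δ * N) ^ 2 + 4 * N ^ 2 / (N * (p / n ^ 2)) * (δ * N))
      = N ^ 2 * (n * δ ^ 2 + n * (4 * (n ^ 2 / p) * δ)) := by
    field_simp
  rw [hid]
  exact mul_le_mul_of_nonneg_left (by linarith) (by positivity)

/-- With `γ = N p / n²` the term `2γ` uses at most half of the budget `N p`, since `n ≥ 2`; each of
the two `δ` terms uses at most a quarter. -/
lemma deflation_error_le {n p δ N : ℝ} (hn : 2 ≤ n) (hp : 0 < p) (hp1 : p ≤ 1)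
    (hδ : δ ≤ p ^ 2 / n ^ 6) (hδ0 : 0 ≤ δ) (hN : 0 < N) :
    2 * (N * (p / n ^ 2)) + n * (N * (δ + n * (δ * N / (N * (p / n ^ 2))))) ≤ N * p := by
  have hn0 : 0 < n := by linarith
  have hδ' : δ * n ^ 6 ≤ p ^ 2 := by rwa [le_div_iff₀ (by positivity)] at hδ
  have h2 : 4 ≤ n ^ 2 := by nlinarith
  have hA : 2 * (p / n ^ 2) ≤ p / 2 := by
    rw [mul_div_assoc', div_le_iff₀ (by positivity)]
    nlinarith
  have hpp : p ^ 2 ≤ p := by nlinarith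
  have h4 : n ^ 4 * δ * 4 ≤ n ^ 6 * δ := by
    rw [show n ^ 6 * δ = n ^ 4 * δ * n ^ 2 by ring]
    exact mul_le_mul_of_nonneg_left h2 (by positivity)
  have hB : n * δ ≤ p / 4 := by
    have : n ≤ n ^ 4 := le_self_pow₀ (by linarith) (by norm_num)
    nlinarith
  have hC : n ^ 4 * δ / p ≤ p / 4 := by
    rw [div_le_iff₀ hp]
    nlinarith
  have hid : 2 * (N * (p / n ^ 2)) + n * (N * (δ + n * (δ * N / (N * (p / n ^ 2)))))
      = N * (2 * (p / n ^ 2) + n * δ + n ^ 4 * δ / p) := by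
    field_simp
    ring
  rw [hid]
  exact mul_le_mul_of_nonneg_left (by linarith) hN.le

end Numerics

end BlockKrylov

/-! ### The good event and the constants. -/

open BlockKrylov in
theorem mainTheorem6 (β c₂ c' : ℝ) (hβ : 0 < β) (hc₂ : 0 < c₂) (hc' : 0 < c') :
    ∃ C : ℝ, 0 < C ∧ ∀ (n l q : ℕ), 1 ≤ l → l ≤ n → C * Real.log n ≤ q →
      ∀ A : Matrix (Fin n) (Fin n) ℝ, A.IsSymm →
        ∃ E : Set (Fin n → Fin l → ℝ), MeasurableSet E ∧
          1 - 1 / (n : ℝ) ^ c' ≤ (BlockKrylov.gaussianBlock n l).real E ∧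
          ∀ X ∈ E, ∀ R : BlockKrylov.Run A (Matrix.of X) q,
            ‖R.P β * A * R.P β‖ ≤ 2 * BlockKrylov.sigma A l + ‖A‖ / (n : ℝ) ^ c₂ := by
  -- The starting vector `X y` has norm at most `n ^ (2c' + 11)`, and the target accuracy is `δ = n
  -- ^ (-(2c₂ + 2β + 6))`.
  refine ⟨2 * ((2 * c' + 11) + (2 * c₂ + 2 * β + 6)), by positivity, ?_⟩
  intro n l q hl hln hq A hA
  rcases Nat.lt_or_ge n 2 with hn1 | hn2
  -- For `n = 1` the required probability is zero, so the empty event suffices.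
  · obtain rfl : n = 1 := by omega
    exact ⟨∅, MeasurableSet.empty, by simp, by simp⟩
  have hn : (2 : ℝ) ≤ n := by exact_mod_cast hn2
  have hn0 : (0 : ℝ) < n := by linarith
  have hln' : (l : ℝ) ≤ n := by exact_mod_cast hln
  obtain ⟨b, μ, hb, hμ⟩ := exists_eigenbasis (toEuclideanLin_isSymmetric hA)
    (finrank_euclideanSpace_fin (n := n)) l
  set U : Matrix (Fin n) (Fin l) ℝ := Matrix.of fun a (i : Fin l) => b (Fin.castLE hln i) a
  have hUU : Uᵀ * U = 1 := by
    ext i k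
    have h := orthonormal_iff_ite.1 b.orthonormal (Fin.castLE hln i) (Fin.castLE hln k)
    rw [Matrix.one_apply]
    simp only [Fin.castLE_inj] at h
    rw [← h]
    exact (inner_toLp (b (Fin.castLE hln i)).ofLp (b (Fin.castLE hln k)).ofLp).symm
  -- The failure probability `3 n l ε` is then at most `3 n² / n ^ (c' + 4) ≤ n ^ (-c')`.
  set ε : ℝ := (n : ℝ) ^ (-(c' + 4)) with hε
  have hε0 : 0 < ε := by positivity
  have hε1 : ε ≤ 1 := Real.rpow_le_one_of_one_le_of_nonpos (by linarith) (by linarith)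
  refine ⟨goodBlocks U ε, measurableSet_goodBlocks U ε, ?_, fun X hX R => ?_⟩
  · have hbad : (gaussianBlock n l).real (goodBlocks U ε)ᶜ ≤ 1 / (n : ℝ) ^ c' := by
      refine ENNReal.toReal_le_of_le_ofReal (by positivity)
        ((gaussianBlock_compl_goodBlocks_le U hUU hε0 hε1).trans (ENNReal.ofReal_le_ofReal ?_))
      have h4 : ε = 1 / (n : ℝ) ^ c' / (n : ℝ) ^ 4 := by
        rw [hε, neg_add, Real.rpow_add hn0, Real.rpow_neg hn0.le, Real.rpow_neg hn0.le]
        norm_cast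
        field_simp
      rw [h4, mul_div_assoc', div_le_iff₀ (by positivity), mul_comm]
      refine mul_le_mul_of_nonneg_left ?_ (by positivity)
      have h1 : (3 : ℝ) * n * l ≤ 3 * n * n := by gcongr
      have h2 : (4 : ℝ) ≤ (n : ℝ) ^ 2 := by nlinarith
      nlinarith [mul_pos hn0 hn0]
    rw [probReal_compl_eq_one_sub (measurableSet_goodBlocks U ε)] at hbad
    linarith
  -- The margin `γ` is proportional to `‖A‖` and must be positive, so `A = 0` is treated apart.
  · rcases eq_or_ne A 0 with rfl | hA0
    · have : 0 ≤ sigma (0 : Matrix (Fin n) (Fin n) ℝ) l := LinearMap.singularValues_nonneg _ _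
      simpa using this
    have hN : 0 < ‖A‖ := norm_pos_iff.2 hA0
    set p : ℝ := (n : ℝ) ^ (-c₂) with hp
    set e : ℝ := (n : ℝ) ^ (-(2 * β)) with he
    have hp0 : 0 < p := by positivity
    have he0 : 0 < e := by positivity
    have hp1 : p ≤ 1 := Real.rpow_le_one_of_one_le_of_nonpos (by linarith) (by linarith)
    have he1 : e ≤ 1 := Real.rpow_le_one_of_one_le_of_nonpos (by linarith) (by linarith)
    have hδ : (2 / 3) ^ (2 * q + 1) * (n * (l * (n / ε ^ 2))) ≤ p ^ 2 * e / (n : ℝ) ^ 6 := by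
      have h1 := two_thirds_pow_mul_rpow_le hn (a := 2 * c' + 11) (d := 2 * c₂ + 2 * β + 6) hq
      have h2 : (n : ℝ) ^ (-(2 * c₂ + 2 * β + 6)) = p ^ 2 * e / (n : ℝ) ^ 6 := by
        rw [hp, he, ← Real.rpow_natCast, ← Real.rpow_natCast, ← Real.rpow_mul hn0.le,
          ← Real.rpow_add hn0, ← Real.rpow_sub hn0]
        congr 1; push_cast; ring
      have h3 : (n : ℝ) ^ (2 * c' + 11) = n * (n * (n / ε ^ 2)) := by
        have : (n : ℝ) * (n * (n / ε ^ 2)) = (n : ℝ) ^ (3 : ℕ) / ε ^ 2 := by ring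
        rw [this, hε, ← Real.rpow_natCast, ← Real.rpow_natCast, ← Real.rpow_mul hn0.le,
          ← Real.rpow_sub hn0]
        congr 1; push_cast; ring
      rw [← h2]
      refine le_trans ?_ h1
      rw [h3]
      gcongr
    have hδ0 : 0 ≤ p ^ 2 * e / (n : ℝ) ^ 6 := by positivity
    have hfinal := R.norm_P_mul_mul_P_le hA hln (β := β) hb hμ hε0
      (γ := ‖A‖ * (p / (n : ℝ) ^ 2)) (by positivity) hX hδ (by
        refine (residual_tolerance_le hn hp0 hp1 he0 he1 le_rfl hδ0 hN).trans (le_of_eq ?_)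
        rw [div_pow, he, Real.rpow_neg hn0.le, ← Real.rpow_natCast _ 2,
          ← Real.rpow_natCast ((n : ℝ) ^ β), ← Real.rpow_mul hn0.le, mul_comm 2 β]
        simp [div_eq_mul_inv])
    have herr := deflation_error_le hn hp0 hp1 (δ := p ^ 2 * e / (n : ℝ) ^ 6)
      (by gcongr; exact mul_le_of_le_one_right (by positivity) he1) hδ0 hN
    have hpn : ‖A‖ / (n : ℝ) ^ c₂ = ‖A‖ * p := by
      rw [hp, Real.rpow_neg hn0.le, div_eq_mul_inv]
    rw [hpn]
    linarith
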